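/- Let $n\ge 1$, let $\Omega\subset\mathbb R^n$ be open, and let $V$ be a real Banach space. Let $X(\Omega)$ be a Banach function space over $\Omega$ with Lebesgue measure, i.e. a Banach space of (a.e. classes of) real-valued measurable functions on $\Omega$, with $\|f\|_X:=\infty$ for measurable $f\notin X(\Omega)$, such that: (i) if $|f|\le g$ a.e. with $f$ measurable and $g\in X(\Omega)$, then $f\in X(\Omega)$ and $\|f\|_X\le\|g\|_X$; (ii) if $0\le f_k\nearrow f$ a.e., then $\|f_k\|_X\nearrow\|f\|_X$; (iii) $\chi_A\in X(\Omega)$ for every measurable $A\subset\Omega$ with $|A|<\infty$; (iv) for every measurable $A\subset\Omega$ with $|A|<\infty$ there is $C_A>0$ with $\int_A|f|\,dx\le C_A\|f\chi_A\|_X$ for all $f\in X(\Omega)$. Let $X(\Omega;V)$ be the space of strongly measurable $u:\Omega\to V$ with $\|u(\cdot)\|_V\in X(\Omega)$, with norm $\|u\|_{X(\Omega;V)}=\big\|\|u(\cdot)\|_V\big\|_X$. Let $W^1X(\Omega;V)$ be the space of those $u\in X(\Omega;V)$ whose weak partial derivatives $\partial_1u,\dots,\partial_nu$ exist (in $L^1_{loc}(\Omega;V)$,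 tested against $C_0^\infty(\Omega)$) and belong to $X(\Omega;V)$, with norm $$\|u\|_{W^1X}=\|u\|_{X(\Omega;V)}+\||\nabla u|\|_X,\qquad |\nabla u|=\Big(\sum_{j=1}^n\|\partial_ju\|_V^2\Big)^{1/2},$$ and write $W^1X(\Omega)=W^1X(\Omega;\mathbb R)$. Let $R^1X(\Omega;V)$ be the set of those $u\in X(\Omega;V)$ such that (A) $\langle v^*,u\rangle\in W^1X(\Omega)$ for every $v^*\in V^*$ with $\|v^*\|\le1$, and (B) there is a non-negative $g\in X(\Omega)$ such that for every $v^*\in V^*$ with $\|v^*\|\le1$ one has $|\nabla\langle v^*,u\rangle|\le g$ a.e. on $\Omega$. A function $g$ as in (B) is called a Reshetnyak upper gradient of $u$, and $\|u\|_{R^1X}=\|u\|_{X(\Omega;V)}+\inf\|g\|_X$, the infimum being over all Reshetnyak upper gradients $g$ of $u$. The space $V$ has the Radon-Nikodým property if for every $\sigma$-finite complete measure space $(S,\Sigma,\mu)$ and every countably additive $\nu:\Sigma\to V$ of bounded variation that is absolutely continuous with respect to $\mu$ there is $f\in L^1(S,\mu;V)$ with $\nu(A)=\int_Af\,d\mu$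 for all $A\in\Sigma$. Then: 1. If $u\in W^1X(\Omega;V)$, then $u\in R^1X(\Omega;V)$; moreover $|\nabla u|$ is a Reshetnyak upper gradient of $u$ and $\|u\|_{R^1X}\le\|u\|_{W^1X}$. 2. If $V$ has the Radon-Nikodým property and $u\in R^1X(\Omega;V)$, then $u\in W^1X(\Omega;V)$ and $\|u\|_{W^1X}\le\sqrt n\,\|u\|_{R^1X}$. -/

import Mathlib

open MeasureTheory Set Filter Topology
open scoped ENNReal NNReal

noncomputable section

namespace VectorSobolev

/-- A Banach function space `X(Ω)` over `Ω ⊆ ℝⁿ` with Lebesgue measure.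

Real valued measurable functions on `Ω` are represented by functions on `ℝⁿ` that are a.e.
measurable for Lebesgue measure restricted to `Ω`, up to equality a.e. on `Ω`. The norm is extended
by the value `⊤` to the measurable functions that are not in the space, so that `f ∈ X(Ω)` iff
`f` is measurable and `fnorm f < ⊤`. Values of `fnorm` at non-measurable functions are irrelevant. -/
structure BanachFunctionSpace {n : ℕ} (Ω : Set (EuclideanSpace ℝ (Fin n))) where
  /-- the extended norm -/
  fnorm : (EuclideanSpace ℝ (Fin n) → ℝ) → ℝ≥0∞
  /-- functions that agree a.e. on `Ω` are identified -/
  fnorm_congr : ∀ f g : EuclideanSpace ℝ (Fin n) → ℝ,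
    AEMeasurable f (volume.restrict Ω) → f =ᵐ[volume.restrict Ω] g → fnorm f = fnorm g
  fnorm_eq_zero : ∀ f : EuclideanSpace ℝ (Fin n) → ℝ, AEMeasurable f (volume.restrict Ω) →
    (fnorm f = 0 ↔ f =ᵐ[volume.restrict Ω] 0)
  fnorm_smul : ∀ (c : ℝ) (f : EuclideanSpace ℝ (Fin n) → ℝ), AEMeasurable f (volume.restrict Ω) →
    fnorm (c • f) = ‖c‖ₑ * fnorm f
  fnorm_add_le : ∀ f g : EuclideanSpace ℝ (Fin n) → ℝ, AEMeasurable f (volume.restrict Ω) →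
    AEMeasurable g (volume.restrict Ω) → fnorm (f + g) ≤ fnorm f + fnorm g
  /-- completeness -/
  complete : ∀ f : ℕ → EuclideanSpace ℝ (Fin n) → ℝ,
    (∀ k, AEMeasurable (f k) (volume.restrict Ω) ∧ fnorm (f k) < ⊤) →
    (∀ ε : ℝ≥0∞, 0 < ε → ∃ N, ∀ k ≥ N, ∀ l ≥ N, fnorm (f k - f l) < ε) →
    ∃ g : EuclideanSpace ℝ (Fin n) → ℝ, (AEMeasurable g (volume.restrict Ω) ∧ fnorm g < ⊤) ∧
      Tendsto (fun k => fnorm (f k - g)) atTop (𝓝 0)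
  /-- the lattice property -/
  lattice : ∀ f g : EuclideanSpace ℝ (Fin n) → ℝ, AEMeasurable f (volume.restrict Ω) →
    AEMeasurable g (volume.restrict Ω) → (∀ᵐ x ∂volume.restrict Ω, |f x| ≤ g x) →
    fnorm f ≤ fnorm g
  /-- the Fatou property -/
  fatou : ∀ (f : ℕ → EuclideanSpace ℝ (Fin n) → ℝ) (g : EuclideanSpace ℝ (Fin n) → ℝ),
    (∀ k, AEMeasurable (f k) (volume.restrict Ω)) → AEMeasurable g (volume.restrict Ω) →
    (∀ᵐ x ∂volume.restrict Ω, (∀ k, 0 ≤ f k x) ∧ Monotone (fun k => f k x) ∧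
      Tendsto (fun k => f k x) atTop (𝓝 (g x))) →
    Tendsto (fun k => fnorm (f k)) atTop (𝓝 (fnorm g))
  /-- characteristic functions of sets of finite measure belong to the space -/
  indicator_lt_top : ∀ A : Set (EuclideanSpace ℝ (Fin n)), MeasurableSet A → A ⊆ Ω →
    volume A < ⊤ → fnorm (A.indicator 1) < ⊤
  /-- the space embeds into `L¹` on sets of finite measure -/
  lintegral_le : ∀ A : Set (EuclideanSpace ℝ (Fin n)), MeasurableSet A → A ⊆ Ω →
    volume A < ⊤ → ∃ C : ℝ≥0, 0 < C ∧ ∀ f : EuclideanSpace ℝ (Fin n) → ℝ,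
      AEMeasurable f (volume.restrict Ω) → fnorm f < ⊤ →
      ∫⁻ x in A, ‖f x‖ₑ ≤ C * fnorm (A.indicator f)

section Spaces

variable {n : ℕ} {Ω : Set (EuclideanSpace ℝ (Fin n))}
variable {V : Type*} [NormedAddCommGroup V] [NormedSpace ℝ V]

/-- `g ∈ X(Ω)` for a real valued function `g`. -/
def MemX (X : BanachFunctionSpace Ω) (g : EuclideanSpace ℝ (Fin n) → ℝ) : Prop :=
  AEMeasurable g (volume.restrict Ω) ∧ X.fnorm g < ⊤

/-- `u ∈ X(Ω; V)`: `u` is strongly measurable on `Ω` and `‖u(·)‖ ∈ X(Ω)`. -/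
def MemXV (X : BanachFunctionSpace Ω) (u : EuclideanSpace ℝ (Fin n) → V) : Prop :=
  AEStronglyMeasurable u (volume.restrict Ω) ∧ MemX X (fun x => ‖u x‖)

/-- The norm of `X(Ω; V)`. -/
def normXV (X : BanachFunctionSpace Ω) (u : EuclideanSpace ℝ (Fin n) → V) : ℝ≥0∞ :=
  X.fnorm (fun x => ‖u x‖)

/-- `v ∈ L¹_loc(Ω; V)` is a weak partial derivative of `u ∈ L¹_loc(Ω; V)` with respect to the
`j`-th coordinate. -/
def HasWeakPartialDeriv (Ω : Set (EuclideanSpace ℝ (Fin n))) (j : Fin n)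
    (u v : EuclideanSpace ℝ (Fin n) → V) : Prop :=
  LocallyIntegrableOn u Ω ∧ LocallyIntegrableOn v Ω ∧
    ∀ φ : EuclideanSpace ℝ (Fin n) → ℝ, ContDiff ℝ (⊤ : ℕ∞) φ → HasCompactSupport φ → tsupport φ ⊆ Ω →
      ∫ x in Ω, (fderiv ℝ φ x (EuclideanSpace.single j 1)) • u x = -∫ x in Ω, φ x • v x

/-- Weak partial derivatives on an open set are unique up to equality a.e. -/
theorem HasWeakPartialDeriv.ae_eq [CompleteSpace V] (hΩ : IsOpen Ω) {j : Fin n}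
    {u v w : EuclideanSpace ℝ (Fin n) → V}
    (hv : HasWeakPartialDeriv Ω j u v) (hw : HasWeakPartialDeriv Ω j u w) :
    v =ᵐ[volume.restrict Ω] w := by
  have key : ∀ᵐ x ∂(volume : Measure (EuclideanSpace ℝ (Fin n))), x ∈ Ω → (v - w) x = 0 := by
    refine hΩ.ae_eq_zero_of_integral_contDiff_smul_eq_zero (hv.2.1.sub hw.2.1) ?_
    intro φ hφ hc hs
    have hint : ∀ f : EuclideanSpace ℝ (Fin n) → V, LocallyIntegrableOn f Ω →
        Integrable (fun x => φ x • f x) := by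
      intro f hf
      have hK : IntegrableOn f (tsupport φ) :=
        hf.integrableOn_compact_subset hs hc.isCompact
      have h1 : IntegrableOn (fun x => φ x • f x) (tsupport φ) :=
        hK.continuousOn_smul hφ.continuous.continuousOn hc.isCompact
      refine (integrableOn_iff_integrable_of_support_subset ?_).1 h1
      intro x hx
      refine subset_tsupport φ ?_
      intro h0
      exact hx (by simp [h0])
    have hset : ∀ f : EuclideanSpace ℝ (Fin n) → V,
        ∫ x in Ω, φ x • f x = ∫ x, φ x • f x := by
      intro f
      refine setIntegral_eq_integral_of_forall_compl_eq_zero ?_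
      intro x hx
      have : φ x = 0 := image_eq_zero_of_notMem_tsupport (fun h => hx (hs h))
      simp [this]
    have e1 := hv.2.2 φ hφ hc hs
    have e2 := hw.2.2 φ hφ hc hs
    have e3 : ∫ x, φ x • v x = ∫ x, φ x • w x := by
      rw [← hset v, ← hset w]
      exact neg_injective (e1.symm.trans e2)
    simp only [Pi.sub_apply, smul_sub]
    rw [integral_sub (hint v hv.2.1) (hint w hw.2.1), e3, sub_self]
  rw [Filter.EventuallyEq, ae_restrict_iff' hΩ.measurableSet]
  filter_upwards [key] with x hx hxΩ
  exact sub_eq_zero.1 (hx hxΩ)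

open Classical in
/-- The weak partial derivative `∂_j u` on `Ω` (a representative of it), with value `0` if there is
none. -/
def weakPartial (Ω : Set (EuclideanSpace ℝ (Fin n))) (j : Fin n)
    (u : EuclideanSpace ℝ (Fin n) → V) : EuclideanSpace ℝ (Fin n) → V :=
  if h : ∃ v, HasWeakPartialDeriv Ω j u v then h.choose else 0

/-- `|∇u| = (∑_j ‖∂_j u‖²)^{1/2}`. -/
def gradNorm (Ω : Set (EuclideanSpace ℝ (Fin n))) (u : EuclideanSpace ℝ (Fin n) → V) :
    EuclideanSpace ℝ (Fin n) → ℝ :=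
  fun x => Real.sqrt (∑ j : Fin n, ‖weakPartial Ω j u x‖ ^ 2)

/-- `u ∈ W¹X(Ω; V)`. -/
def MemW1X (X : BanachFunctionSpace Ω) (u : EuclideanSpace ℝ (Fin n) → V) : Prop :=
  MemXV X u ∧ ∀ j : Fin n, ∃ v, HasWeakPartialDeriv Ω j u v ∧ MemXV X v

/-- The norm of `W¹X(Ω; V)`. -/
def normW1X (X : BanachFunctionSpace Ω) (u : EuclideanSpace ℝ (Fin n) → V) : ℝ≥0∞ :=
  normXV X u + X.fnorm (gradNorm Ω u)

/-- `g` is a Reshetnyak upper gradient of `u`. -/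
def IsReshetnyakUpperGradient (X : BanachFunctionSpace Ω) (u : EuclideanSpace ℝ (Fin n) → V)
    (g : EuclideanSpace ℝ (Fin n) → ℝ) : Prop :=
  (∀ᵐ x ∂volume.restrict Ω, 0 ≤ g x) ∧ MemX X g ∧
    ∀ v' : V →L[ℝ] ℝ, ‖v'‖ ≤ 1 →
      ∀ᵐ x ∂volume.restrict Ω, gradNorm Ω (fun y => v' (u y)) x ≤ g x

/-- `u ∈ R¹X(Ω; V)`. -/
def MemR1X (X : BanachFunctionSpace Ω) (u : EuclideanSpace ℝ (Fin n) → V) : Prop :=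
  MemXV X u ∧ (∀ v' : V →L[ℝ] ℝ, ‖v'‖ ≤ 1 → MemW1X X (fun x => v' (u x))) ∧
    ∃ g, IsReshetnyakUpperGradient X u g

/-- The norm of `R¹X(Ω; V)`. -/
def normR1X (X : BanachFunctionSpace Ω) (u : EuclideanSpace ℝ (Fin n) → V) : ℝ≥0∞ :=
  normXV X u + ⨅ (g : EuclideanSpace ℝ (Fin n) → ℝ) (_ : IsReshetnyakUpperGradient X u g), X.fnorm g

end Spaces

/-- The Radon-Nikodym property of a Banach space `V`: every `V`-valued measure of bounded variation
that is absolutely continuous with respect to a `σ`-finite complete measure has an integrable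
density. -/
def HasRadonNikodymProperty (V : Type*) [NormedAddCommGroup V] [NormedSpace ℝ V] : Prop :=
  ∀ (S : Type) [MeasurableSpace S] (μ : Measure S) [SigmaFinite μ] [μ.IsComplete]
    (ν : VectorMeasure S V), ν.variation univ < ⊤ →
    (∀ A, MeasurableSet A → μ A = 0 → ν A = 0) →
    ∃ f : S → V, Integrable f μ ∧ ∀ A, MeasurableSet A → ν A = ∫ x in A, f x ∂μ

end VectorSobolev

end

/-! Part 1 holds because a bounded functional passes through the weak derivative: ∂_j⟨v*,u⟩ =
⟨v*,∂_j u⟩, whose modulus is at most ‖∂_j u‖ when ‖v*‖ ≤ 1.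

For part 2, fix j. The scalar derivatives w_{v*} = ∂_j⟨v*,u⟩ are all dominated by one g, and a
V-valued function representing them must be found. On an open U with compact closure in Ω, take
smooth cutoffs φ_k → χ_U. The vectors -∫ ∂_jφ_k u form a Cauchy sequence, since domination bounds
their distances by ∫_U (1-φ_k)g + ∫_U (1-φ_l)g; hence there is a vector in V itself, not only in the
bidual, representing the integrals of all w_{v*} over U (`exists_isPettisIntegral_of_isOpen`). A π-λ
argument extends this to Borel sets A. The vectors z_A are countably additive with ‖z_A‖ ≤ ∫_A g, so
the Radon-Nikodým property supplies a local density (`HasRadonNikodymProperty.exists_density`).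

The densities glue to some v with ⟨v*,v⟩ = w_{v*} a.e.; then ‖v‖ ≤ g by separability
(`ae_norm_le_of_forall_unit_dual`), and v = ∂_j u because functionals separate points. Each ‖∂_j u‖
is thus at most g, so |∇u| ≤ √n g. -/

noncomputable section

namespace VectorSobolev

/-! ### Vector-valued integrals of dominated scalar families, and their densities. -/

section Pettis

variable {α : Type*} [MeasurableSpace α] {μ : Measure α}
variable {V : Type*} [NormedAddCommGroup V] [NormedSpace ℝ V]

/-- A vector is determined by the values of the functionals in the unit ball of the dual. -/
theorem eq_of_forall_unit_dual {x y : V} (h : ∀ v' : V →L[ℝ] ℝ, ‖v'‖ ≤ 1 → v' x = v' y) :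
    x = y := by
  obtain ⟨v', hv', hxy⟩ := exists_dual_vector'' ℝ (x - y)
  rw [map_sub, h v' hv', sub_self] at hxy
  exact sub_eq_zero.1 (norm_eq_zero.1 (by simpa using hxy.symm))

/-- A function with separable range is bounded in norm by any common a.e. bound of its
compositions with functionals in the unit ball of the dual. -/
theorem ae_norm_le_of_forall_unit_dual {v : α → V} {g : α → ℝ} (hv : AEStronglyMeasurable v μ)
    (h : ∀ v' : V →L[ℝ] ℝ, ‖v'‖ ≤ 1 → ∀ᵐ x ∂μ, v' (v x) ≤ g x) : ∀ᵐ x ∂μ, ‖v x‖ ≤ g x := by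
  obtain ⟨t, ⟨d, hdc, hd⟩, ht⟩ := hv.isSeparable_ae_range
  have : Countable d := hdc.to_subtype
  -- Functionals norming the points of a countable dense set suffice, so only countably many
  -- exceptional null sets are discarded.
  choose s hs1 hs2 using fun y : d => exists_dual_vector'' ℝ (y : V)
  have hall : ∀ᵐ x ∂μ, ∀ y : d, s y (v x) ≤ g x := ae_all_iff.2 fun y => h (s y) (hs1 y)
  filter_upwards [hall, ht] with x hx hxt
  refine le_of_forall_pos_le_add fun ε hε => ?_
  obtain ⟨y, hy, hxy⟩ := Metric.mem_closure_iff.1 (hd hxt) (ε / 2) (half_pos hε)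
  rw [dist_eq_norm] at hxy
  have h1 : ‖v x‖ ≤ ‖y‖ + ‖v x - y‖ := norm_le_insert' _ _
  have h2 : s ⟨y, hy⟩ y = ‖y‖ := hs2 ⟨y, hy⟩
  have h3 : s ⟨y, hy⟩ (y - v x) ≤ ‖v x - y‖ := by
    refine (le_abs_self _).trans ?_
    have := (s ⟨y, hy⟩).le_of_opNorm_le (hs1 ⟨y, hy⟩) (y - v x)
    rwa [one_mul, norm_sub_rev] at this
  rw [map_sub, h2] at h3
  linarith [hx ⟨y, hy⟩]

/-- `z` is the vector valued integral over `A` of the family `w` of scalar functions indexed by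
the unit ball of the dual space. -/
def IsPettisIntegral (μ : Measure α) (w : (V →L[ℝ] ℝ) → α → ℝ) (A : Set α) (z : V) : Prop :=
  ∀ v' : V →L[ℝ] ℝ, ‖v'‖ ≤ 1 → v' z = ∫ x in A, w v' x ∂μ

/-- The family `w` is dominated by the integrable function `g`. -/
structure IsDominatedFamily (μ : Measure α) (w : (V →L[ℝ] ℝ) → α → ℝ) (g : α → ℝ) : Prop where
  integrable_bound : Integrable g μ
  aestronglyMeasurable : ∀ v' : V →L[ℝ] ℝ, ‖v'‖ ≤ 1 → AEStronglyMeasurable (w v') μ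
  norm_le : ∀ v' : V →L[ℝ] ℝ, ‖v'‖ ≤ 1 → ∀ᵐ x ∂μ, ‖w v' x‖ ≤ g x

variable {w : (V →L[ℝ] ℝ) → α → ℝ} {g : α → ℝ} {A : Set α} {z : V}

namespace IsDominatedFamily

theorem integrable (h : IsDominatedFamily μ w g) {v' : V →L[ℝ] ℝ} (hv' : ‖v'‖ ≤ 1) :
    Integrable (w v') μ :=
  h.integrable_bound.mono' (h.aestronglyMeasurable v' hv') (h.norm_le v' hv')

theorem bound_nonneg (h : IsDominatedFamily μ w g) : 0 ≤ᵐ[μ] g := by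
  filter_upwards [h.norm_le 0 (by simp)] with x hx
  exact (norm_nonneg _).trans hx

end IsDominatedFamily

namespace IsPettisIntegral

theorem unique {z' : V} (hz : IsPettisIntegral μ w A z) (hz' : IsPettisIntegral μ w A z') :
    z = z' :=
  eq_of_forall_unit_dual fun v' hv' => (hz v' hv').trans (hz' v' hv').symm

/-- Test with a functional norming `z`. Convergence of series, finite variation and the Cauchy
estimate for cutoffs all rest on this bound. -/
theorem norm_le (h : IsDominatedFamily μ w g) (hz : IsPettisIntegral μ w A z) :
    ‖z‖ ≤ ∫ x in A, g x ∂μ := by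
  obtain ⟨v', hv', hvz⟩ := exists_dual_vector'' ℝ z
  have hvz' : ‖z‖ = v' z := by simpa using hvz.symm
  rw [hvz', hz v' hv']
  refine integral_mono_ae (h.integrable hv').integrableOn h.integrable_bound.integrableOn
    (ae_restrict_of_ae ?_)
  filter_upwards [h.norm_le v' hv'] with x hx
  exact (le_abs_self _).trans hx

/-- The norms of the terms are bounded by the integrals of `g` over disjoint sets, so the series
converges absolutely; functionals then identify its sum. -/
theorem exists_hasSum [CompleteSpace V] (h : IsDominatedFamily μ w g) {s : ℕ → Set α} {z : ℕ → V}
    (hs : ∀ i, MeasurableSet (s i)) (hd : Pairwise (Function.onFun Disjoint s))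
    (hz : ∀ i, IsPettisIntegral μ w (s i) (z i)) :
    ∃ y, HasSum z y ∧ IsPettisIntegral μ w (⋃ i, s i) y := by
  have hsum : Summable z := by
    refine Summable.of_norm_bounded
      (hasSum_integral_iUnion hs hd h.integrable_bound.integrableOn).summable fun i => ?_
    exact (hz i).norm_le h
  refine ⟨_, hsum.hasSum, fun v' hv' => ?_⟩
  have h1 := v'.hasSum hsum.hasSum
  have h2 := hasSum_integral_iUnion hs hd (h.integrable hv').integrableOn
  simp only [← hz _ v' hv'] at h2
  exact h1.unique h2

/-- The representable sets form a Dynkin class: complements by subtraction from the integral over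
`univ`, disjoint unions by `exists_hasSum`. -/
theorem exists_of_piSystem [CompleteSpace V] (h : IsDominatedFamily μ w g) {C : Set (Set α)}
    (hgen : ‹MeasurableSpace α› = MeasurableSpace.generateFrom C) (hC : IsPiSystem C)
    (huniv : ∃ z, IsPettisIntegral μ w univ z) (hz : ∀ A ∈ C, ∃ z, IsPettisIntegral μ w A z)
    (hA : MeasurableSet A) : ∃ z, IsPettisIntegral μ w A z := by
  induction A, hA using MeasurableSpace.induction_on_inter hgen hC with
  | empty => exact ⟨0, fun v' _ => by simp⟩
  | basic t ht => exact hz t ht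
  | compl t ht ih =>
    obtain ⟨y, hy⟩ := huniv
    obtain ⟨z, hz⟩ := ih
    refine ⟨y - z, fun v' hv' => ?_⟩
    rw [map_sub, hy v' hv', hz v' hv', setIntegral_univ, setIntegral_compl ht (h.integrable hv')]
  | iUnion f hd hf ih =>
    choose z hz using ih
    obtain ⟨y, -, hy⟩ := exists_hasSum h hf hd hz
    exact ⟨y, hy⟩

end IsPettisIntegral

open Classical in
/-- The vector measure given by the integrals of a dominated family. -/
def pettisMeasure [CompleteSpace V] (h : IsDominatedFamily μ w g)
    (hz : ∀ A, MeasurableSet A → ∃ z, IsPettisIntegral μ w A z) : VectorMeasure α V where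
  -- The choice is immaterial, since the representing vector is unique.
  measureOf' A := if hA : MeasurableSet A then (hz A hA).choose else 0
  empty' := by
    rw [dif_pos MeasurableSet.empty]
    exact (hz ∅ .empty).choose_spec.unique fun v' _ => by simp
  not_measurable' A hA := dif_neg hA
  m_iUnion' s hs hd := by
    obtain ⟨y, hy, hy'⟩ := IsPettisIntegral.exists_hasSum h hs hd
      (fun i => (hz (s i) (hs i)).choose_spec)
    have e : (hz (⋃ i, s i) (.iUnion hs)).choose = y := (hz _ (.iUnion hs)).choose_spec.unique hy'
    simp only [dif_pos (hs _), dif_pos (MeasurableSet.iUnion hs)]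
    rw [e]
    exact hy

theorem isPettisIntegral_pettisMeasure [CompleteSpace V] (h : IsDominatedFamily μ w g)
    (hz : ∀ A, MeasurableSet A → ∃ z, IsPettisIntegral μ w A z)
    (hA : MeasurableSet A) : IsPettisIntegral μ w A (pettisMeasure h hz A) := by
  have e : pettisMeasure h hz A = (hz A hA).choose := dif_pos hA
  rw [e]
  exact (hz A hA).choose_spec

theorem variation_pettisMeasure_lt_top [CompleteSpace V] (h : IsDominatedFamily μ w g)
    (hz : ∀ A, MeasurableSet A → ∃ z, IsPettisIntegral μ w A z) :
    (pettisMeasure h hz).variation univ < ⊤ := by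
  have hle : (pettisMeasure h hz).variation ≤ μ.withDensity fun x => ENNReal.ofReal (g x) := by
    refine VectorMeasure.variation_le_of_forall_enorm_le fun E hE => ?_
    rw [withDensity_apply _ hE, ← ofReal_integral_eq_lintegral_ofReal
      h.integrable_bound.integrableOn (ae_restrict_of_ae h.bound_nonneg), ← ofReal_norm]
    exact ENNReal.ofReal_le_ofReal ((isPettisIntegral_pettisMeasure h hz hE).norm_le h)
  refine (hle univ).trans_lt ?_
  rw [withDensity_apply _ .univ, setLIntegral_univ,
    ← ofReal_integral_eq_lintegral_ofReal h.integrable_bound h.bound_nonneg]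
  exact ENNReal.ofReal_lt_top

/-! ### Passage to the completed measure, as the Radon-Nikodým property concerns complete measures.
-/

/-- The identity map from a measure space with its completed `σ`-algebra to the space itself. -/
def ofCompletion (μ : Measure α) : NullMeasurableSpace α μ → α := fun x => x

/-- The identity map from a measure space to the same space with its completed `σ`-algebra. -/
def toCompletion (μ : Measure α) : α → NullMeasurableSpace α μ := fun x => x

theorem measurePreserving_ofCompletion (μ : Measure α) :
    MeasurePreserving (ofCompletion μ) μ.completion μ := by
  have hm : Measurable (ofCompletion μ) := fun s hs => hs.nullMeasurableSet (μ := μ)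
  refine ⟨hm, Measure.ext fun s hs => ?_⟩
  rw [Measure.map_apply hm hs]
  rfl

theorem exists_ofCompletion_preimage_ae_eq {A : Set (NullMeasurableSpace α μ)}
    (hA : MeasurableSet A) :
    ∃ B : Set α, MeasurableSet B ∧ A =ᵐ[μ.completion] ofCompletion μ ⁻¹' B :=
  hA

instance sigmaFinite_completion [SigmaFinite μ] : SigmaFinite μ.completion :=
  ⟨⟨⟨fun i => ofCompletion μ ⁻¹' spanningSets μ i, fun _ => trivial, fun i =>
    measure_spanningSets_lt_top μ i, by rw [← preimage_iUnion, iUnion_spanningSets]; rfl⟩⟩⟩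

/-- `toCompletion μ` need not be measurable, so composition yields only null measurability. This
upgrades to a.e. measurability because the range is a.e. contained in a separable set. -/
theorem aestronglyMeasurable_comp_toCompletion {F : Type*} [NormedAddCommGroup F]
    {f : NullMeasurableSpace α μ → F}
    (hf : AEStronglyMeasurable f μ.completion) :
    AEStronglyMeasurable (fun x => f (toCompletion μ x)) μ := by
  borelize F
  obtain ⟨t, ht, hft⟩ := hf.isSeparable_ae_range
  obtain ⟨f', hf', hff'⟩ := hf.aemeasurable
  have hff : (fun x => f (toCompletion μ x)) =ᵐ[μ] fun x => f' (toCompletion μ x) := hff'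
  have hft' : ∀ᵐ x ∂μ, f (toCompletion μ x) ∈ t := hft
  have hf't : ∀ᵐ x ∂μ, f' (toCompletion μ x) ∈ t := by
    filter_upwards [hff, hft'] with x hx hxt
    rwa [← hx]
  have : SecondCountableTopology t := by
    have := ht.separableSpace
    exact UniformSpace.secondCountable_of_separable t
  have hnull : NullMeasurable (fun x => f' (toCompletion μ x)) μ := fun s hs => hf' hs
  exact (aestronglyMeasurable_iff_aemeasurable_separable.2
    ⟨hnull.aemeasurable_of_aerange hf't, t, ht, hf't⟩).congr hff.symm

end Pettis

theorem HasRadonNikodymProperty.exists_density_of_isComplete {α : Type} [MeasurableSpace α]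
    {μ : Measure α} [SigmaFinite μ] [μ.IsComplete]
    {V : Type*} [NormedAddCommGroup V] [NormedSpace ℝ V] [CompleteSpace V]
    (hV : HasRadonNikodymProperty V) {w : (V →L[ℝ] ℝ) → α → ℝ} {g : α → ℝ}
    (h : IsDominatedFamily μ w g) (hz : ∀ A, MeasurableSet A → ∃ z, IsPettisIntegral μ w A z) :
    ∃ f : α → V, Integrable f μ ∧
      ∀ v' : V →L[ℝ] ℝ, ‖v'‖ ≤ 1 → (fun x => v' (f x)) =ᵐ[μ] w v' := by
  obtain ⟨f, hf, hfA⟩ := hV α μ (pettisMeasure h hz) (variation_pettisMeasure_lt_top h hz)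
    (fun A hA h0 => (isPettisIntegral_pettisMeasure h hz hA).unique fun v' _ => by
      rw [map_zero, setIntegral_measure_zero _ h0])
  refine ⟨f, hf, fun v' hv' => ?_⟩
  refine Integrable.ae_eq_of_forall_setIntegral_eq _ _ (v'.integrable_comp hf)
    (h.integrable hv') fun s hs _ => ?_
  rw [← isPettisIntegral_pettisMeasure h hz hs v' hv', hfA s hs,
    v'.integral_comp_comm hf.integrableOn]

/-- In a space with the Radon-Nikodym property, a dominated family of scalar functions whose
integrals over measurable sets are represented by vectors is represented by a vector valued
function. -/
theorem HasRadonNikodymProperty.exists_density {α : Type} [MeasurableSpace α] {μ : Measure α}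
    [SigmaFinite μ] {V : Type*} [NormedAddCommGroup V] [NormedSpace ℝ V] [CompleteSpace V]
    (hV : HasRadonNikodymProperty V) {w : (V →L[ℝ] ℝ) → α → ℝ} {g : α → ℝ}
    (h : IsDominatedFamily μ w g) (hz : ∀ A, MeasurableSet A → ∃ z, IsPettisIntegral μ w A z) :
    ∃ f : α → V, Integrable f μ ∧
      ∀ v' : V →L[ℝ] ℝ, ‖v'‖ ≤ 1 → (fun x => v' (f x)) =ᵐ[μ] w v' := by
  have hT := measurePreserving_ofCompletion μ
  have h' : IsDominatedFamily μ.completion (fun v' x => w v' (ofCompletion μ x))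
      (fun x => g (ofCompletion μ x)) :=
    ⟨hT.integrable_comp_of_integrable h.integrable_bound,
      fun v' hv' => (h.aestronglyMeasurable v' hv').comp_measurePreserving hT,
      fun v' hv' => hT.quasiMeasurePreserving.ae (h.norm_le v' hv')⟩
  -- A set of the completed σ-algebra differs by a null set from some measurable `B`, so the vector
  -- for `B` serves for it too.
  obtain ⟨f, hf, hfw⟩ := hV.exists_density_of_isComplete h' fun A hA => by
    obtain ⟨B, hB, hAB⟩ := exists_ofCompletion_preimage_ae_eq hA
    obtain ⟨z, hz⟩ := hz B hB
    refine ⟨z, fun v' hv' => ?_⟩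
    have hTB := hT.restrict_preimage hB
    rw [hz v' hv', setIntegral_congr_set hAB]
    conv_lhs => rw [← hTB.map_eq]
    refine integral_map hTB.measurable.aemeasurable ?_
    rw [hTB.map_eq]
    exact (h.aestronglyMeasurable v' hv').restrict
  have hfm := aestronglyMeasurable_comp_toCompletion hf.1
  exact ⟨fun x => f (toCompletion μ x), (hT.integrable_comp hfm).1 hf, fun v' hv' => hfw v' hv'⟩

/-! ### Construction of the vector-valued weak derivative. -/

section WeakDerivative

variable {n : ℕ} {Ω : Set (EuclideanSpace ℝ (Fin n))}
variable {V : Type*} [NormedAddCommGroup V] [NormedSpace ℝ V]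

theorem integrable_smul_of_tsupport_subset {f : EuclideanSpace ℝ (Fin n) → V}
    (hf : LocallyIntegrableOn f Ω) {φ : EuclideanSpace ℝ (Fin n) → ℝ} (hφ : Continuous φ)
    (hc : HasCompactSupport φ) (hs : tsupport φ ⊆ Ω) : Integrable (fun x => φ x • f x) := by
  have h1 : IntegrableOn (fun x => φ x • f x) (tsupport φ) :=
    (hf.integrableOn_compact_subset hs hc.isCompact).continuousOn_smul hφ.continuousOn hc.isCompact
  refine (integrableOn_iff_integrable_of_support_subset fun x hx => subset_tsupport φ ?_).1 h1
  intro h0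
  exact hx (by simp [h0])

theorem integrable_fderiv_smul_of_tsupport_subset {f : EuclideanSpace ℝ (Fin n) → V}
    (hf : LocallyIntegrableOn f Ω) {φ : EuclideanSpace ℝ (Fin n) → ℝ}
    (hφ : ContDiff ℝ (⊤ : ℕ∞) φ) (hc : HasCompactSupport φ) (hs : tsupport φ ⊆ Ω)
    (e : EuclideanSpace ℝ (Fin n)) : Integrable (fun x => fderiv ℝ φ x e • f x) :=
  integrable_smul_of_tsupport_subset hf
    ((hφ.continuous_fderiv (by simp)).clm_apply continuous_const)
    (hc.fderiv_apply (𝕜 := ℝ) e) ((tsupport_fderiv_apply_subset ℝ e).trans hs)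

/-- Take a smooth `f ≥ 0` with support exactly `U`; a smooth step applied to `k * f` equals 1 at a
given point of `U` once `k * f ≥ 1` there. -/
theorem exists_smooth_cutoff_tendsto {U : Set (EuclideanSpace ℝ (Fin n))} (hU : IsOpen U) :
    ∃ φ : ℕ → EuclideanSpace ℝ (Fin n) → ℝ, (∀ k, ContDiff ℝ (⊤ : ℕ∞) (φ k)) ∧
      (∀ k, Function.support (φ k) ⊆ U) ∧ (∀ k x, 0 ≤ φ k x) ∧ (∀ k x, φ k x ≤ 1) ∧
      ∀ x ∈ U, Tendsto (fun k => φ k x) atTop (𝓝 1) := by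
  obtain ⟨f, hfU, hf, hf01⟩ := hU.exists_contDiff_support_eq (n := ⊤)
  refine ⟨fun k x => Real.smoothTransition (k * f x), fun k => ?_, fun k x hx => ?_,
    fun k x => Real.smoothTransition.nonneg _, fun k x => Real.smoothTransition.le_one _,
    fun x hx => ?_⟩
  · exact Real.smoothTransition.contDiff.comp (contDiff_const.mul hf)
  · rw [← hfU]
    intro h0
    exact hx (by simp [h0])
  · have hx0 : f x ≠ 0 := by rwa [← hfU] at hx
    have hpos : 0 < f x := lt_of_le_of_ne (hf01 ⟨x, rfl⟩).1 hx0.symm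
    refine tendsto_const_nhds.congr' ?_
    filter_upwards [(tendsto_natCast_atTop_atTop.atTop_mul_const hpos).eventually_ge_atTop 1]
      with k hk
    exact (Real.smoothTransition.one_of_one_le hk).symm

/-- Integration by parts turns the integrals of `φ k * w v'` into functionals of honest vectors `z
k`, which converge by domination. The cutoffs are supported in `U`, so compactness of its closure
inside `Ω` makes them admissible test functions. -/
theorem exists_isPettisIntegral_of_isOpen [CompleteSpace V] (hΩ : MeasurableSet Ω) {j : Fin n}
    {U : Set (EuclideanSpace ℝ (Fin n))} (hU : IsOpen U) (hUc : IsCompact (closure U))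
    (hUΩ : closure U ⊆ Ω) {u : EuclideanSpace ℝ (Fin n) → V} (hu : LocallyIntegrableOn u Ω)
    {w : (V →L[ℝ] ℝ) → EuclideanSpace ℝ (Fin n) → ℝ}
    (hw : ∀ v' : V →L[ℝ] ℝ, ‖v'‖ ≤ 1 → HasWeakPartialDeriv Ω j (fun x => v' (u x)) (w v'))
    {g : EuclideanSpace ℝ (Fin n) → ℝ} (h : IsDominatedFamily (volume.restrict U) w g) :
    ∃ z, IsPettisIntegral volume w U z := by
  obtain ⟨φ, hφ, hφU, hφ0, hφ1, hφlim⟩ := exists_smooth_cutoff_tendsto hU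
  have hts : ∀ k, tsupport (φ k) ⊆ closure U := fun k => closure_mono (hφU k)
  have hφc : ∀ k, HasCompactSupport (φ k) := fun k =>
    hUc.of_isClosed_subset (isClosed_tsupport _) (hts k)
  have hφΩ : ∀ k, tsupport (φ k) ⊆ Ω := fun k => (hts k).trans hUΩ
  have hUsub : U ⊆ Ω := subset_closure.trans hUΩ
  let z : ℕ → V := fun k => -∫ x in Ω, (fderiv ℝ (φ k) x (EuclideanSpace.single j 1)) • u x
  have hz : ∀ k (v' : V →L[ℝ] ℝ), ‖v'‖ ≤ 1 → v' (z k) = ∫ x in U, φ k x * w v' x := by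
    intro k v' hv'
    have hint := (integrable_fderiv_smul_of_tsupport_subset hu (hφ k) (hφc k) (hφΩ k)
      (EuclideanSpace.single j 1)).integrableOn (s := Ω)
    rw [map_neg, ← v'.integral_comp_comm hint]
    simp only [map_smul]
    rw [(hw v' hv').2.2 (φ k) (hφ k) (hφc k) (hφΩ k), neg_neg]
    refine setIntegral_eq_of_subset_of_forall_sdiff_eq_zero hΩ hUsub fun x hx => ?_
    rw [Function.notMem_support.1 fun h0 => hx.2 (hφU k h0), zero_smul]
  have hlim : ∀ᵐ x ∂volume.restrict U, Tendsto (fun k => φ k x) atTop (𝓝 1) :=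
    (ae_restrict_iff' hU.measurableSet).2 (Eventually.of_forall hφlim)
  let a : ℕ → ℝ := fun k => ∫ x in U, (1 - φ k x) * g x
  have hbnd : ∀ k x, ‖1 - φ k x‖ ≤ 1 := fun k x => by
    rw [Real.norm_eq_abs, abs_le]; constructor <;> linarith [hφ0 k x, hφ1 k x]
  have hcont : ∀ k, Continuous (φ k) := fun k => (hφ k).continuous
  have haint : ∀ k, Integrable (fun x => (1 - φ k x) * g x) (volume.restrict U) := fun k =>
    h.integrable_bound.bdd_mul (c := 1)
      (continuous_const.sub (hcont k)).aestronglyMeasurable (Eventually.of_forall (hbnd k))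
  have ha : Tendsto a atTop (𝓝 0) := by
    have := tendsto_integral_of_dominated_convergence (μ := volume.restrict U)
      (F := fun k x => (1 - φ k x) * g x) (f := fun _ => 0) g (fun k => (haint k).1)
      h.integrable_bound
      (fun k => by
        filter_upwards [h.bound_nonneg] with x hx
        rw [norm_mul, Real.norm_of_nonneg hx]
        exact mul_le_of_le_one_left hx (hbnd k x))
      (by
        filter_upwards [hlim] with x hx
        simpa using ((tendsto_const_nhds (x := (1 : ℝ))).sub hx).mul_const (g x))
    simpa using this
  -- From |φ_k - φ_l| ≤ (1 - φ_k) + (1 - φ_l), the difference `z k - z l` represents a family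
  -- dominated by the sum of the two integrands.
  have hzz : ∀ k l, dist (z k) (z l) ≤ a k + a l := by
    intro k l
    have hdom : IsDominatedFamily (volume.restrict U) (fun v' x => (φ k x - φ l x) * w v' x)
        (fun x => (1 - φ k x) * g x + (1 - φ l x) * g x) := by
      refine ⟨(haint k).add (haint l), fun v' hv' => ?_, fun v' hv' => ?_⟩
      · exact ((hcont k).sub (hcont l)).aestronglyMeasurable.mul (h.aestronglyMeasurable v' hv')
      · filter_upwards [h.norm_le v' hv'] with x hx
        rw [norm_mul, ← add_mul]
        refine mul_le_mul ?_ hx (norm_nonneg _) ?_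
        · rw [Real.norm_eq_abs, abs_le]
          constructor <;> linarith [hφ1 k x, hφ1 l x]
        · linarith [hφ1 k x, hφ1 l x]
    have hP : IsPettisIntegral (volume.restrict U) (fun v' x => (φ k x - φ l x) * w v' x)
        univ (z k - z l) := by
      intro v' hv'
      have hi : ∀ m, Integrable (fun x => φ m x * w v' x) (volume.restrict U) := fun m =>
        (h.integrable hv').bdd_mul (c := 1) (hcont m).aestronglyMeasurable
          (Eventually.of_forall fun x => by
            rw [Real.norm_of_nonneg (hφ0 m x)]; exact hφ1 m x)
      simp only [setIntegral_univ, sub_mul]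
      rw [map_sub, hz k v' hv', hz l v' hv', integral_sub (hi k) (hi l)]
    rw [dist_eq_norm]
    refine (hP.norm_le hdom).trans_eq ?_
    rw [setIntegral_univ, integral_add (haint k) (haint l)]
  have hcau : CauchySeq z := by
    refine Metric.cauchySeq_iff.2 fun ε hε => ?_
    obtain ⟨N, hN⟩ := eventually_atTop.1 (ha.eventually (gt_mem_nhds (half_pos hε)))
    exact ⟨N, fun k hk l hl => (hzz k l).trans_lt (by linarith [hN k hk, hN l hl])⟩
  obtain ⟨y, hy⟩ := cauchySeq_tendsto_of_complete hcau
  refine ⟨y, fun v' hv' => ?_⟩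
  have h1 : Tendsto (fun k => v' (z k)) atTop (𝓝 (v' y)) := (v'.continuous.tendsto y).comp hy
  simp only [hz _ v' hv'] at h1
  refine tendsto_nhds_unique h1 ?_
  refine tendsto_integral_of_dominated_convergence g
    (fun k => (hcont k).aestronglyMeasurable.mul (h.aestronglyMeasurable v' hv'))
    h.integrable_bound (fun k => ?_) ?_
  · filter_upwards [h.norm_le v' hv'] with x hx
    rw [norm_mul, Real.norm_of_nonneg (hφ0 k x)]
    exact (mul_le_of_le_one_left (norm_nonneg _) (hφ1 k x)).trans hx
  · filter_upwards [hlim] with x hx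
    simpa using hx.mul_const (w v' x)

theorem exists_isOpen_isCompact_closure_cover (hΩ : IsOpen Ω) :
    ∃ U : ℕ → Set (EuclideanSpace ℝ (Fin n)), (∀ m, IsOpen (U m)) ∧
      (∀ m, IsCompact (closure (U m))) ∧ (∀ m, closure (U m) ⊆ Ω) ∧ ⋃ m, U m = Ω := by
  obtain ⟨F, hFc, hFΩ, hF, hFm⟩ := hΩ.exists_iUnion_isClosed
  have hK : ∀ m : ℕ, IsCompact (F m ∩ Metric.closedBall 0 m) := fun m =>
    (isCompact_closedBall 0 (m : ℝ)).inter_left (hFc m)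
  choose U hU hKU hUΩ hUc using fun m => exists_open_between_and_isCompact_closure (hK m) hΩ
    (inter_subset_left.trans (hFΩ m))
  refine ⟨U, hU, hUc, hUΩ, subset_antisymm (iUnion_subset fun m => subset_closure.trans (hUΩ m))
    fun x hx => ?_⟩
  rw [← hF] at hx
  obtain ⟨m, hm⟩ := mem_iUnion.1 hx
  obtain ⟨N, hN⟩ := exists_nat_ge ‖x‖
  -- The closed sets increase, so one index serves for both the closed set and the ball.
  refine mem_iUnion.2 ⟨max m N, hKU _ ⟨hFm (le_max_left m N) hm, ?_⟩⟩
  rw [mem_closedBall_zero_iff]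
  exact hN.trans (by exact_mod_cast le_max_right m N)

theorem exists_glue_ae {α F : Type*} [NormedAddCommGroup F] [MeasurableSpace α] {μ : Measure α}
    {D : ℕ → Set α}
    (hD : ∀ m, MeasurableSet (D m)) (hd : Pairwise (Function.onFun Disjoint D)) {f : ℕ → α → F}
    (hf : ∀ m, AEStronglyMeasurable (f m) (μ.restrict (D m))) :
    ∃ v : α → F, AEStronglyMeasurable v (μ.restrict (⋃ m, D m)) ∧
      ∀ m, v =ᵐ[μ.restrict (D m)] f m := by
  classical
  let v : α → F := fun x => if hx : ∃ m, x ∈ D m then f hx.choose x else 0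
  have hv : ∀ m, ∀ x ∈ D m, v x = f m x := by
    intro m x hx
    have hex : ∃ m, x ∈ D m := ⟨m, hx⟩
    have e : hex.choose = m := by
      by_contra hne
      exact (hd hne).le_bot ⟨hex.choose_spec, hx⟩
    simp only [v, dif_pos hex, e]
  have hv' : ∀ m, v =ᵐ[μ.restrict (D m)] f m := fun m =>
    (ae_restrict_iff' (hD m)).2 (Eventually.of_forall (hv m))
  exact ⟨v, aestronglyMeasurable_iUnion_iff.2 fun m => (hf m).congr (hv' m).symm, hv'⟩

theorem HasRadonNikodymProperty.exists_weakPartial [CompleteSpace V]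
    (hV : HasRadonNikodymProperty V) (hΩ : IsOpen Ω) {j : Fin n}
    {u : EuclideanSpace ℝ (Fin n) → V} (hu : LocallyIntegrableOn u Ω)
    {w : (V →L[ℝ] ℝ) → EuclideanSpace ℝ (Fin n) → ℝ}
    (hw : ∀ v' : V →L[ℝ] ℝ, ‖v'‖ ≤ 1 → HasWeakPartialDeriv Ω j (fun x => v' (u x)) (w v'))
    {g : EuclideanSpace ℝ (Fin n) → ℝ} (hg : LocallyIntegrableOn g Ω)
    (hwg : ∀ v' : V →L[ℝ] ℝ, ‖v'‖ ≤ 1 → ∀ᵐ x ∂volume.restrict Ω, ‖w v' x‖ ≤ g x) :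
    ∃ v : EuclideanSpace ℝ (Fin n) → V, HasWeakPartialDeriv Ω j u v ∧
      ∀ v' : V →L[ℝ] ℝ, ‖v'‖ ≤ 1 → (fun x => v' (v x)) =ᵐ[volume.restrict Ω] w v' := by
  obtain ⟨U, hU, hUc, hUΩ, hUcover⟩ := exists_isOpen_isCompact_closure_cover hΩ
  have hUsub : ∀ m, U m ⊆ Ω := fun m => subset_closure.trans (hUΩ m)
  have hdom : ∀ A, A ⊆ Ω → IntegrableOn g A → IsDominatedFamily (volume.restrict A) w g :=
    fun A hA hgA => ⟨hgA,
      fun v' hv' => (hw v' hv').2.1.aestronglyMeasurable.mono_measure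
        (Measure.restrict_mono_set _ hA),
      fun v' hv' => ae_restrict_of_ae_restrict_of_subset hA (hwg v' hv')⟩
  have hgU : ∀ A m, A ⊆ U m → IntegrableOn g A := fun A m hA =>
    (hg.integrableOn_compact_subset (hUΩ m) (hUc m)).mono_set (hA.trans subset_closure)
  have hloc : ∀ m, ∃ f : EuclideanSpace ℝ (Fin n) → V, Integrable f (volume.restrict (U m)) ∧
      ∀ v' : V →L[ℝ] ℝ, ‖v'‖ ≤ 1 → (fun x => v' (f x)) =ᵐ[volume.restrict (U m)] w v' := by
    intro m
    have hopen : ∀ A, IsOpen A → ∃ z, IsPettisIntegral (volume.restrict (U m)) w A z := by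
      intro A hA
      obtain ⟨z, hz⟩ := exists_isPettisIntegral_of_isOpen hΩ.measurableSet (hA.inter (hU m))
        ((hUc m).closure_of_subset (inter_subset_right.trans subset_closure))
        ((closure_mono inter_subset_right).trans (hUΩ m)) hu hw
        (hdom _ (inter_subset_right.trans (hUsub m)) (hgU _ m inter_subset_right))
      refine ⟨z, fun v' hv' => ?_⟩
      rw [hz v' hv', Measure.restrict_restrict hA.measurableSet]
    have hdU := hdom _ (hUsub m) (hgU _ m subset_rfl)
    refine hV.exists_density hdU fun A hA => ?_
    exact IsPettisIntegral.exists_of_piSystem hdU (BorelSpace.measurable_eq) isPiSystem_isOpen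
      (hopen univ isOpen_univ) hopen hA
  choose f hf hfw using hloc
  have hDsub : ∀ m, disjointed U m ⊆ U m := disjointed_subset U
  obtain ⟨v, hvm, hv⟩ := exists_glue_ae (μ := volume) (D := disjointed U)
    (fun m => MeasurableSet.disjointed (fun k => (hU k).measurableSet) m) (disjoint_disjointed U)
    (fun m => (hf m).1.mono_measure (Measure.restrict_mono_set _ (hDsub m)))
  rw [iUnion_disjointed, hUcover] at hvm
  have hvw : ∀ v' : V →L[ℝ] ℝ, ‖v'‖ ≤ 1 →
      (fun x => v' (v x)) =ᵐ[volume.restrict Ω] w v' := by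
    intro v' hv'
    rw [EventuallyEq, ← hUcover, ← iUnion_disjointed, ae_restrict_iUnion_iff]
    intro m
    filter_upwards [hv m, ae_restrict_of_ae_restrict_of_subset (hDsub m) (hfw m v' hv')]
      with x hx hxw
    rw [hx, hxw]
  -- This bound makes the glued function, so far only measurable, locally integrable on all of `Ω`.
  have hvg : ∀ᵐ x ∂volume.restrict Ω, ‖v x‖ ≤ g x := by
    refine ae_norm_le_of_forall_unit_dual hvm fun v' hv' => ?_
    filter_upwards [hvw v' hv', hwg v' hv'] with x hx hxg
    rw [hx]
    exact (le_abs_self _).trans hxg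
  have hvloc : LocallyIntegrableOn v Ω := by
    refine (locallyIntegrableOn_iff hΩ.isLocallyClosed).2 fun K hK hKc => ?_
    exact (hg.integrableOn_compact_subset hK hKc).mono'
      (hvm.mono_measure (Measure.restrict_mono_set _ hK))
      (ae_restrict_of_ae_restrict_of_subset hK hvg)
  refine ⟨v, ⟨hu, hvloc, fun φ hφ hc hs => eq_of_forall_unit_dual fun v' hv' => ?_⟩, hvw⟩
  have h1 := (integrable_fderiv_smul_of_tsupport_subset hu hφ hc hs
    (EuclideanSpace.single j 1)).integrableOn (s := Ω)
  have h2 := (integrable_smul_of_tsupport_subset hvloc hφ.continuous hc hs).integrableOn (s := Ω)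
  rw [map_neg, ← v'.integral_comp_comm h1, ← v'.integral_comp_comm h2]
  simp only [map_smul]
  rw [(hw v' hv').2.2 φ hφ hc hs]
  congr 1
  refine integral_congr_ae ?_
  filter_upwards [hvw v' hv'] with x hx
  rw [hx]

end WeakDerivative

/-! ### Membership and norm estimates in W¹X and R¹X. -/

section FunctionSpace

variable {n : ℕ} {Ω : Set (EuclideanSpace ℝ (Fin n))} {X : BanachFunctionSpace Ω}
variable {V : Type*} [NormedAddCommGroup V] [NormedSpace ℝ V]

theorem MemX.mono {f g : EuclideanSpace ℝ (Fin n) → ℝ} (hg : MemX X g)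
    (hf : AEMeasurable f (volume.restrict Ω)) (h : ∀ᵐ x ∂volume.restrict Ω, |f x| ≤ g x) :
    MemX X f :=
  ⟨hf, (X.lattice f g hf hg.1 h).trans_lt hg.2⟩

theorem MemX.add {f g : EuclideanSpace ℝ (Fin n) → ℝ} (hf : MemX X f) (hg : MemX X g) :
    MemX X (f + g) :=
  ⟨hf.1.add hg.1, (X.fnorm_add_le f g hf.1 hg.1).trans_lt (ENNReal.add_lt_top.2 ⟨hf.2, hg.2⟩)⟩

theorem memX_zero (X : BanachFunctionSpace Ω) : MemX X 0 := by
  refine ⟨aemeasurable_const, ?_⟩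
  rw [(X.fnorm_eq_zero 0 aemeasurable_const).2 (ae_eq_refl 0)]
  exact ENNReal.zero_lt_top

theorem MemX.sum {ι : Type*} (s : Finset ι) {f : ι → EuclideanSpace ℝ (Fin n) → ℝ}
    (hf : ∀ i ∈ s, MemX X (f i)) : MemX X (∑ i ∈ s, f i) :=
  Finset.sum_induction f (MemX X) (fun _ _ => MemX.add) (memX_zero X) hf

theorem MemX.locallyIntegrableOn (hΩ : IsOpen Ω) {g : EuclideanSpace ℝ (Fin n) → ℝ}
    (hg : MemX X g) (h0 : ∀ᵐ x ∂volume.restrict Ω, 0 ≤ g x) : LocallyIntegrableOn g Ω := by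
  refine (locallyIntegrableOn_iff hΩ.isLocallyClosed).2 fun K hK hKc => ?_
  obtain ⟨C, -, hC⟩ := X.lintegral_le K hKc.measurableSet hK hKc.measure_lt_top
  have hind : X.fnorm (K.indicator g) < ⊤ := by
    refine (hg.mono (hg.1.indicator hKc.measurableSet) ?_).2
    filter_upwards [h0] with x hx
    by_cases hxK : x ∈ K
    · simp [hxK, abs_of_nonneg hx]
    · simp [hxK, hx]
  exact ⟨(hg.1.mono_measure (Measure.restrict_mono_set _ hK)).aestronglyMeasurable,
    (hC g hg.1 hg.2).trans_lt (ENNReal.mul_lt_top ENNReal.coe_lt_top hind)⟩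

theorem MemXV.locallyIntegrableOn {F : Type*} [NormedAddCommGroup F]
    (hΩ : IsOpen Ω) {u : EuclideanSpace ℝ (Fin n) → F}
    (hu : MemXV X u) : LocallyIntegrableOn u Ω := by
  have h := hu.2.locallyIntegrableOn hΩ (Eventually.of_forall fun x => norm_nonneg (u x))
  refine (locallyIntegrableOn_iff hΩ.isLocallyClosed).2 fun K hK hKc => ?_
  exact (integrable_norm_iff (hu.1.mono_measure (Measure.restrict_mono_set _ hK))).1
    (h.integrableOn_compact_subset hK hKc)

theorem MemX.memXV_of_norm_le {F : Type*} [NormedAddCommGroup F]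
    {g : EuclideanSpace ℝ (Fin n) → ℝ} (hg : MemX X g)
    {u : EuclideanSpace ℝ (Fin n) → F} (hu : AEStronglyMeasurable u (volume.restrict Ω))
    (h : ∀ᵐ x ∂volume.restrict Ω, ‖u x‖ ≤ g x) : MemXV X u :=
  ⟨hu, hg.mono hu.norm.aemeasurable (by simpa using h)⟩

theorem norm_apply_le_of_norm_le_one {v' : V →L[ℝ] ℝ} (hv' : ‖v'‖ ≤ 1) (x : V) :
    ‖v' x‖ ≤ ‖x‖ := by
  simpa using v'.le_of_opNorm_le hv' x

theorem MemXV.clm_apply {u : EuclideanSpace ℝ (Fin n) → V} (hu : MemXV X u)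
    {v' : V →L[ℝ] ℝ} (hv' : ‖v'‖ ≤ 1) : MemXV X (fun x => v' (u x)) :=
  hu.2.memXV_of_norm_le (v'.continuous.comp_aestronglyMeasurable hu.1)
    (Eventually.of_forall fun x => norm_apply_le_of_norm_le_one hv' (u x))

theorem LocallyIntegrableOn.clm_apply (hΩ : IsOpen Ω) {u : EuclideanSpace ℝ (Fin n) → V}
    (hu : LocallyIntegrableOn u Ω) (v' : V →L[ℝ] ℝ) :
    LocallyIntegrableOn (fun x => v' (u x)) Ω :=
  (locallyIntegrableOn_iff hΩ.isLocallyClosed).2 fun _ hK hKc =>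
    v'.integrable_comp (hu.integrableOn_compact_subset hK hKc)

theorem HasWeakPartialDeriv.clm_apply [CompleteSpace V] (hΩ : IsOpen Ω) {j : Fin n}
    {u v : EuclideanSpace ℝ (Fin n) → V} (h : HasWeakPartialDeriv Ω j u v) (v' : V →L[ℝ] ℝ) :
    HasWeakPartialDeriv Ω j (fun x => v' (u x)) (fun x => v' (v x)) := by
  refine ⟨LocallyIntegrableOn.clm_apply hΩ h.1 v', LocallyIntegrableOn.clm_apply hΩ h.2.1 v',
    fun φ hφ hc hs => ?_⟩
  have h1 := (integrable_fderiv_smul_of_tsupport_subset h.1 hφ hc hs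
    (EuclideanSpace.single j 1)).integrableOn (s := Ω)
  have h2 := (integrable_smul_of_tsupport_subset h.2.1 hφ.continuous hc hs).integrableOn (s := Ω)
  have e := congrArg v' (h.2.2 φ hφ hc hs)
  rw [map_neg, ← v'.integral_comp_comm h1, ← v'.integral_comp_comm h2] at e
  simpa only [map_smul] using e

theorem hasWeakPartialDeriv_weakPartial {j : Fin n} {u : EuclideanSpace ℝ (Fin n) → V}
    (h : ∃ v, HasWeakPartialDeriv Ω j u v) : HasWeakPartialDeriv Ω j u (weakPartial Ω j u) := by
  rw [weakPartial, dif_pos h]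
  exact h.choose_spec

theorem HasWeakPartialDeriv.weakPartial_ae_eq [CompleteSpace V] (hΩ : IsOpen Ω) {j : Fin n}
    {u v : EuclideanSpace ℝ (Fin n) → V} (h : HasWeakPartialDeriv Ω j u v) :
    weakPartial Ω j u =ᵐ[volume.restrict Ω] v :=
  (hasWeakPartialDeriv_weakPartial ⟨v, h⟩).ae_eq hΩ h

theorem gradNorm_nonneg (u : EuclideanSpace ℝ (Fin n) → V) (x : EuclideanSpace ℝ (Fin n)) :
    0 ≤ gradNorm Ω u x :=
  Real.sqrt_nonneg _

theorem norm_weakPartial_le_gradNorm (j : Fin n) (u : EuclideanSpace ℝ (Fin n) → V)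
    (x : EuclideanSpace ℝ (Fin n)) : ‖weakPartial Ω j u x‖ ≤ gradNorm Ω u x :=
  Real.le_sqrt_of_sq_le (Finset.single_le_sum (f := fun i => ‖weakPartial Ω i u x‖ ^ 2)
    (fun _ _ => sq_nonneg _) (Finset.mem_univ j))

theorem gradNorm_le_sum (u : EuclideanSpace ℝ (Fin n) → V) (x : EuclideanSpace ℝ (Fin n)) :
    gradNorm Ω u x ≤ ∑ j, ‖weakPartial Ω j u x‖ :=
  Real.sqrt_le_iff.2 ⟨Finset.sum_nonneg fun _ _ => norm_nonneg _,
    Finset.sum_sq_le_sq_sum_of_nonneg fun _ _ => norm_nonneg _⟩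

theorem gradNorm_le_sqrt_mul {u : EuclideanSpace ℝ (Fin n) → V} {x : EuclideanSpace ℝ (Fin n)}
    {c : ℝ} (h : ∀ j, ‖weakPartial Ω j u x‖ ≤ c) (hc : 0 ≤ c) :
    gradNorm Ω u x ≤ Real.sqrt n * c := by
  refine Real.sqrt_le_iff.2 ⟨by positivity, ?_⟩
  rw [mul_pow, Real.sq_sqrt n.cast_nonneg]
  refine (Finset.sum_le_card_nsmul _ _ (c ^ 2) fun j _ =>
    pow_le_pow_left₀ (norm_nonneg _) (h j) 2).trans_eq ?_
  simp

theorem aemeasurable_gradNorm {u : EuclideanSpace ℝ (Fin n) → V}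
    (h : ∀ j, ∃ v, HasWeakPartialDeriv Ω j u v) :
    AEMeasurable (gradNorm Ω u) (volume.restrict Ω) := by
  have hj : ∀ j, AEMeasurable (fun x => ‖weakPartial Ω j u x‖ ^ 2) (volume.restrict Ω) := fun j =>
    (hasWeakPartialDeriv_weakPartial (h j)).2.1.aestronglyMeasurable.norm.aemeasurable.pow_const 2
  exact (Finset.aemeasurable_fun_sum _ fun j _ => hj j).sqrt

theorem MemW1X.memXV_weakPartial [CompleteSpace V] (hΩ : IsOpen Ω)
    {u : EuclideanSpace ℝ (Fin n) → V} (hu : MemW1X X u) (j : Fin n) :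
    MemXV X (weakPartial Ω j u) := by
  obtain ⟨v, hv, hvX⟩ := hu.2 j
  have e := hv.weakPartial_ae_eq hΩ
  refine hvX.2.memXV_of_norm_le (hvX.1.congr e.symm) ?_
  filter_upwards [e] with x hx
  rw [hx]

theorem MemW1X.memX_gradNorm [CompleteSpace V] (hΩ : IsOpen Ω)
    {u : EuclideanSpace ℝ (Fin n) → V} (hu : MemW1X X u) : MemX X (gradNorm Ω u) := by
  refine (MemX.sum Finset.univ fun j _ => (hu.memXV_weakPartial hΩ j).2).mono
    (aemeasurable_gradNorm fun j => ⟨_, (hu.2 j).choose_spec.1⟩)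
    (Eventually.of_forall fun x => ?_)
  rw [abs_of_nonneg (gradNorm_nonneg u x), Finset.sum_apply]
  exact gradNorm_le_sum u x

theorem MemW1X.clm_apply [CompleteSpace V] (hΩ : IsOpen Ω)
    {u : EuclideanSpace ℝ (Fin n) → V} (hu : MemW1X X u) {v' : V →L[ℝ] ℝ} (hv' : ‖v'‖ ≤ 1) :
    MemW1X X (fun x => v' (u x)) := by
  refine ⟨hu.1.clm_apply hv', fun j => ?_⟩
  obtain ⟨v, hv, hvX⟩ := hu.2 j
  exact ⟨_, hv.clm_apply hΩ v', hvX.clm_apply hv'⟩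

theorem MemW1X.isReshetnyakUpperGradient_gradNorm [CompleteSpace V] (hΩ : IsOpen Ω)
    {u : EuclideanSpace ℝ (Fin n) → V} (hu : MemW1X X u) :
    IsReshetnyakUpperGradient X u (gradNorm Ω u) := by
  refine ⟨Eventually.of_forall (gradNorm_nonneg u), hu.memX_gradNorm hΩ,
    fun v' hv' => ?_⟩
  have hj : ∀ j, ∀ᵐ x ∂volume.restrict Ω,
      weakPartial Ω j (fun y => v' (u y)) x = v' (weakPartial Ω j u x) := fun j =>
    ((hasWeakPartialDeriv_weakPartial ⟨_, (hu.2 j).choose_spec.1⟩).clm_apply hΩ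
      v').weakPartial_ae_eq hΩ
  filter_upwards [ae_all_iff.2 hj] with x hx
  refine Real.sqrt_le_sqrt (Finset.sum_le_sum fun j _ => ?_)
  rw [hx j]
  exact pow_le_pow_left₀ (norm_nonneg _) (norm_apply_le_of_norm_le_one hv' _) 2

theorem MemW1X.memR1X [CompleteSpace V] (hΩ : IsOpen Ω)
    {u : EuclideanSpace ℝ (Fin n) → V} (hu : MemW1X X u) : MemR1X X u :=
  ⟨hu.1, fun _ hv' => hu.clm_apply hΩ hv', _, hu.isReshetnyakUpperGradient_gradNorm hΩ⟩

theorem MemW1X.normR1X_le [CompleteSpace V] (hΩ : IsOpen Ω)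
    {u : EuclideanSpace ℝ (Fin n) → V} (hu : MemW1X X u) : normR1X X u ≤ normW1X X u :=
  add_le_add_right (iInf₂_le _ (hu.isReshetnyakUpperGradient_gradNorm hΩ)) _

/-- Any Reshetnyak upper gradient dominates the weak partial derivatives, as soon as these exist. -/
theorem IsReshetnyakUpperGradient.norm_le_of_hasWeakPartialDeriv [CompleteSpace V] (hΩ : IsOpen Ω)
    {u : EuclideanSpace ℝ (Fin n) → V} {g : EuclideanSpace ℝ (Fin n) → ℝ}
    (hg : IsReshetnyakUpperGradient X u g) {j : Fin n} {v : EuclideanSpace ℝ (Fin n) → V}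
    (hv : HasWeakPartialDeriv Ω j u v) : ∀ᵐ x ∂volume.restrict Ω, ‖v x‖ ≤ g x := by
  refine ae_norm_le_of_forall_unit_dual hv.2.1.aestronglyMeasurable fun v' hv' => ?_
  filter_upwards [(hv.clm_apply hΩ v').weakPartial_ae_eq hΩ, hg.2.2 v' hv'] with x hx hxg
  rw [← hx]
  exact (le_abs_self _).trans ((norm_weakPartial_le_gradNorm j _ x).trans hxg)

theorem MemR1X.memW1X [CompleteSpace V] (hΩ : IsOpen Ω) (hV : HasRadonNikodymProperty V)
    {u : EuclideanSpace ℝ (Fin n) → V} (hu : MemR1X X u) : MemW1X X u := by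
  obtain ⟨huX, huv, g, hg⟩ := hu
  refine ⟨huX, fun j => ?_⟩
  obtain ⟨v, hv, -⟩ := hV.exists_weakPartial hΩ (j := j)
    (w := fun v' => weakPartial Ω j fun y => v' (u y)) (huX.locallyIntegrableOn hΩ)
    (fun v' hv' => hasWeakPartialDeriv_weakPartial ⟨_, ((huv v' hv').2 j).choose_spec.1⟩)
    (hg.2.1.locallyIntegrableOn hΩ hg.1) fun v' hv' => by
      filter_upwards [hg.2.2 v' hv'] with x hx
      exact (norm_weakPartial_le_gradNorm j _ x).trans hx
  exact ⟨v, hv, hg.2.1.memXV_of_norm_le hv.2.1.aestronglyMeasurable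
    (hg.norm_le_of_hasWeakPartialDeriv hΩ hv)⟩

/-- The functional norming ∂_j u(x) may depend on j, so g bounds each partial derivative separately;
summing n squares costs √n. -/
theorem MemW1X.fnorm_gradNorm_le [CompleteSpace V] (hΩ : IsOpen Ω)
    {u : EuclideanSpace ℝ (Fin n) → V} (hu : MemW1X X u) {g : EuclideanSpace ℝ (Fin n) → ℝ}
    (hg : IsReshetnyakUpperGradient X u g) :
    X.fnorm (gradNorm Ω u) ≤ ENNReal.ofReal (Real.sqrt n) * X.fnorm g := by
  have hj : ∀ j, ∀ᵐ x ∂volume.restrict Ω, ‖weakPartial Ω j u x‖ ≤ g x := fun j =>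
    hg.norm_le_of_hasWeakPartialDeriv hΩ
      (hasWeakPartialDeriv_weakPartial ⟨_, (hu.2 j).choose_spec.1⟩)
  rw [← Real.enorm_of_nonneg (Real.sqrt_nonneg _), ← X.fnorm_smul _ g hg.2.1.1]
  refine X.lattice _ _ (hu.memX_gradNorm hΩ).1 (hg.2.1.1.const_smul _) ?_
  filter_upwards [ae_all_iff.2 hj, hg.1] with x hx h0
  rw [abs_of_nonneg (gradNorm_nonneg u x)]
  exact gradNorm_le_sqrt_mul hx h0

theorem MemW1X.normW1X_le [CompleteSpace V] (hn : 1 ≤ n) (hΩ : IsOpen Ω)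
    {u : EuclideanSpace ℝ (Fin n) → V} (hu : MemW1X X u) :
    normW1X X u ≤ ENNReal.ofReal (Real.sqrt n) * normR1X X u := by
  -- Here `n ≥ 1` enters: the factor √n absorbs the X(Ω;V) term and, being nonzero and finite, moves
  -- inside the infimum.
  have h1 : 1 ≤ ENNReal.ofReal (Real.sqrt n) := by
    rw [ENNReal.one_le_ofReal, Real.one_le_sqrt]
    exact_mod_cast hn
  rw [normW1X, normR1X, mul_add]
  refine add_le_add (le_mul_of_one_le_left' h1) ?_
  simp only [ENNReal.mul_iInf_of_ne (zero_lt_one.trans_le h1).ne' ENNReal.ofReal_ne_top]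
  exact le_iInf₂ fun g hg => hu.fnorm_gradNorm_le hΩ hg

end FunctionSpace

end VectorSobolev

end

theorem mainTheorem2 {n : ℕ} (hn : 1 ≤ n) {Ω : Set (EuclideanSpace ℝ (Fin n))} (hΩ : IsOpen Ω)
    (X : VectorSobolev.BanachFunctionSpace Ω)
    {V : Type*} [NormedAddCommGroup V] [NormedSpace ℝ V] [CompleteSpace V] :
    (∀ u : EuclideanSpace ℝ (Fin n) → V, VectorSobolev.MemW1X X u →
      VectorSobolev.MemR1X X u ∧
      VectorSobolev.IsReshetnyakUpperGradient X u (VectorSobolev.gradNorm Ω u) ∧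
      VectorSobolev.normR1X X u ≤ VectorSobolev.normW1X X u) ∧
    (VectorSobolev.HasRadonNikodymProperty V →
      ∀ u : EuclideanSpace ℝ (Fin n) → V, VectorSobolev.MemR1X X u →
        VectorSobolev.MemW1X X u ∧
        VectorSobolev.normW1X X u ≤
          ENNReal.ofReal (Real.sqrt n) * VectorSobolev.normR1X X u) :=
  ⟨fun _ hu => ⟨hu.memR1X hΩ, hu.isReshetnyakUpperGradient_gradNorm hΩ, hu.normR1X_le hΩ⟩,
    fun hV _ hu => ⟨hu.memW1X hΩ hV, (hu.memW1X hΩ hV).normW1X_le hn hΩ⟩⟩
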